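/- Let $X$ be a completely regular Hausdorff space, $C(X)$ the ring of continuous functions $X\to\mathbb R$, and $\beta X$ the Stone–Čech compactification of $X$. An ideal $D$ of a commutative ring $A$ is (rationally) dense if its only annihilator in $A$ is $0$. The maximal ring of quotients of $A$ is the direct limit of the modules $\operatorname{Hom}_A(D,A)$ over all dense ideals $D$ of $A$ (two homomorphisms being identified when they agree on the intersection of their domains), with composition as multiplication. Let $Q(X)$ be the maximal ring of quotients of $C(X)$. If $\mathcal S$ is a nonempty family of dense subsets of a space $Y$ that is closed under finite intersection, let $C[\mathcal S]=\varinjlim_{S\in\mathcal S}C(S)$ be the ring of all continuous real functions on members of $\mathcal S$, where $f_1\in C(S_1)$ and $f_2\in C(S_2)$ are identified when they agree on $S_1\cap S_2$. It is a metric space under $$d(f,g)=\sup_{s}\frac{|f(s)-g(s)|}{1+|f(s)-g(s)|},$$ where the supremum is taken over a common domain in $\mathcal S$ and does not depend on its choice. Let $\mathcal V_0(Y)$ denote the family of all dense open subsets of $Y$ and $\mathcal G_0(Y)$ the family of all dense $G_\delta$ subsets of $Y$. For $Y$ a Baire space, $\mathcal G_0(Y)$ is closed under finite intersection and contains $\mathcal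 V_0(Y)$, so that $C[\mathcal V_0(Y)]\subset C[\mathcal G_0(Y)]$. Each $\varphi\in\operatorname{Hom}(D,C(X))$, with $D$ a dense ideal of $C(X)$, is multiplication by the continuous function $x\mapsto\varphi(d)(x)/d(x)$ ($d\in D$, $d(x)\ne0$) on the dense open set $\{x:\ d(x)\neq 0\text{ for some }d\in D\}$. In this way $Q(X)$ is embedded in $C[\mathcal V_0(X)]$, and it carries the metric $d$ of the latter. Let $\overline{Q}(X)$ be the metric completion of $Q(X)$. **Theorem.** $\overline{Q}(X)=C[\mathcal G_0(\beta X)]$; and if $X$ is a Baire space, then $\overline{Q}(X)=C[\mathcal G_0(X)]$. Explicitly: 1. There is an isometry of $\overline{Q}(X)$ onto $C[\mathcal G_0(\beta X)]$ whose restriction to $Q(X)$ is a ring homomorphism and sends each $q\in Q(X)$ to the class of a continuous function on a dense open subset $W$ of $\beta X$ whose restriction to $W\cap X$ represents $q$ in $C[\mathcal V_0(X)]$. 2. If $X$ is a Baire space, there is an isometry of $\overline{Q}(X)$ onto $C[\mathcal G_0(X)]$ whose restriction to $Q(X)$ is the canonical embedding $Q(X)\subset C[\mathcal V_0(X)]\subset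 C[\mathcal G_0(X)]$ and is a ring homomorphism. -/

import Mathlib

open Set Topology

noncomputable section

/-! ## The maximal ring of quotients of a commutative ring -/

/-- An ideal is rationally dense if its only annihilator in the ring is `0`. -/
def IsRatDense {A : Type*} [CommRing A] (D : Ideal A) : Prop :=
  ∀ a : A, (∀ d ∈ D, a * d = 0) → a = 0

/-- A rationally dense ideal `D` of `A` together with an element of `Hom(D, A)`. -/
structure DenseHom (A : Type*) [CommRing A] where
  dom : Ideal A
  dense : IsRatDense dom
  map : dom →ₗ[A] A

namespace DenseHom

variable {A : Type*} [CommRing A]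

theorem map_mul_right (φ : DenseHom A) (d e : A) (hd : d ∈ φ.dom) (h : d * e ∈ φ.dom) :
    φ.map ⟨d * e, h⟩ = φ.map ⟨d, hd⟩ * e := by
  have : (⟨d * e, h⟩ : φ.dom) = e • ⟨d, hd⟩ := Subtype.ext (by simp [mul_comm])
  rw [this, map_smul, smul_eq_mul, mul_comm]

theorem map_mul_comm (φ : DenseHom A) (d e : φ.dom) :
    φ.map d * (e : A) = φ.map e * (d : A) := by
  have h1 : (e : A) • d = (d : A) • e := Subtype.ext (by simp [mul_comm])
  have h2 := congrArg φ.map h1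
  rw [map_smul, map_smul, smul_eq_mul, smul_eq_mul] at h2
  linear_combination h2

/-- Two homomorphisms are identified when they agree on the intersection of their domains. -/
def Agree (φ ψ : DenseHom A) : Prop :=
  ∀ (d : A) (h₁ : d ∈ φ.dom) (h₂ : d ∈ ψ.dom), φ.map ⟨d, h₁⟩ = ψ.map ⟨d, h₂⟩

instance setoid (A : Type*) [CommRing A] : Setoid (DenseHom A) where
  r := Agree
  iseqv :=
    { refl := fun _ _ _ _ => rfl
      symm := fun h d h₁ h₂ => (h d h₂ h₁).symm
      trans := by
        intro φ ψ χ h k d h₁ h₃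
        rw [← sub_eq_zero]
        refine ψ.dense _ fun e he => ?_
        have p₁ := φ.dom.mul_mem_right e h₁
        have p₂ := ψ.dom.mul_mem_left d he
        have p₃ := χ.dom.mul_mem_right e h₃
        rw [sub_mul, ← φ.map_mul_right d e h₁ p₁, ← χ.map_mul_right d e h₃ p₃,
          h _ p₁ p₂, k _ p₂ p₃, sub_self] }

theorem dense_inf {D E : Ideal A} (hD : IsRatDense D) (hE : IsRatDense E) :
    IsRatDense (D ⊓ E) := by
  intro a ha
  refine hD a fun d hd => hE _ fun e he => ?_
  rw [mul_assoc]
  exact ha _ ⟨D.mul_mem_right e hd, E.mul_mem_left d he⟩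

theorem dense_top : IsRatDense (⊤ : Ideal A) := fun a ha => by
  simpa using ha 1 Submodule.mem_top

/-- Multiplication by `a`, as an element of `Hom(A, A)`. -/
def const (a : A) : DenseHom A where
  dom := ⊤
  dense := dense_top
  map := a • (⊤ : Ideal A).subtype

def add (φ ψ : DenseHom A) : DenseHom A where
  dom := φ.dom ⊓ ψ.dom
  dense := dense_inf φ.dense ψ.dense
  map := φ.map ∘ₗ Submodule.inclusion inf_le_left + ψ.map ∘ₗ Submodule.inclusion inf_le_right

def neg (φ : DenseHom A) : DenseHom A where
  dom := φ.dom
  dense := φ.dense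
  map := -φ.map

/-- The largest ideal on which the composition `φ ∘ ψ` is defined. -/
def compDom (φ ψ : DenseHom A) : Ideal A where
  carrier := {d | ∃ h : d ∈ ψ.dom, ψ.map ⟨d, h⟩ ∈ φ.dom}
  zero_mem' := ⟨ψ.dom.zero_mem, by
    have : (⟨0, ψ.dom.zero_mem⟩ : ψ.dom) = 0 := rfl
    rw [this, map_zero]; exact φ.dom.zero_mem⟩
  add_mem' := by
    rintro a b ⟨ha, ha'⟩ ⟨hb, hb'⟩
    refine ⟨ψ.dom.add_mem ha hb, ?_⟩
    have : (⟨a + b, ψ.dom.add_mem ha hb⟩ : ψ.dom) = ⟨a, ha⟩ + ⟨b, hb⟩ := rfl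
    rw [this, map_add]
    exact φ.dom.add_mem ha' hb'
  smul_mem' := by
    rintro c a ⟨ha, ha'⟩
    refine ⟨ψ.dom.smul_mem c ha, ?_⟩
    have : (⟨c • a, ψ.dom.smul_mem c ha⟩ : ψ.dom) = c • ⟨a, ha⟩ := rfl
    rw [this, map_smul]
    exact φ.dom.smul_mem c ha'

/-- The composition `φ ∘ ψ`. -/
def comp (φ ψ : DenseHom A) : DenseHom A where
  dom := compDom φ ψ
  dense := by
    intro a ha
    refine φ.dense a fun d hd => ψ.dense _ fun e he => ?_
    rw [mul_assoc, mul_comm d e]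
    have h : e * d ∈ ψ.dom := ψ.dom.mul_mem_right d he
    refine ha _ ⟨h, ?_⟩
    rw [ψ.map_mul_right e d he h]
    exact φ.dom.mul_mem_left _ hd
  map :=
    { toFun := fun d => φ.map ⟨ψ.map ⟨d.1, d.2.1⟩, d.2.2⟩
      map_add' := fun x y => by
        rw [← map_add]
        congr 1
        exact Subtype.ext (ψ.map.map_add ⟨x.1, x.2.1⟩ ⟨y.1, y.2.1⟩)
      map_smul' := fun c x => by
        rw [RingHom.id_apply, ← map_smul]
        congr 1
        exact Subtype.ext (ψ.map.map_smul c ⟨x.1, x.2.1⟩) }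

theorem comp_comm (φ ψ : DenseHom A) : Agree (comp φ ψ) (comp ψ φ) := by
  rintro d ⟨h₁, h₁'⟩ ⟨h₂, h₂'⟩
  change φ.map ⟨ψ.map ⟨d, h₁⟩, h₁'⟩ = ψ.map ⟨φ.map ⟨d, h₂⟩, h₂'⟩
  rw [← sub_eq_zero]
  refine φ.dense _ fun e he => ψ.dense _ fun f hf => ?_
  have a₁ := φ.map_mul_comm ⟨_, h₁'⟩ ⟨e, he⟩
  have a₂ := ψ.map_mul_comm ⟨_, h₂'⟩ ⟨f, hf⟩
  have a₃ := φ.map_mul_comm ⟨d, h₂⟩ ⟨e, he⟩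
  have a₄ := ψ.map_mul_comm ⟨d, h₁⟩ ⟨f, hf⟩
  simp only at a₁ a₂ a₃ a₄
  linear_combination f * a₁ - e * a₂ + φ.map ⟨e, he⟩ * a₄ - ψ.map ⟨f, hf⟩ * a₃

theorem comp_congr_right {φ ψ ψ' : DenseHom A} (h : Agree ψ ψ') :
    Agree (comp φ ψ) (comp φ ψ') := by
  rintro d ⟨h₁, h₁'⟩ ⟨h₂, h₂'⟩
  change φ.map ⟨ψ.map ⟨d, h₁⟩, h₁'⟩ = φ.map ⟨ψ'.map ⟨d, h₂⟩, h₂'⟩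
  congr 1
  exact Subtype.ext (h d h₁ h₂)

theorem comp_congr_left {φ φ' ψ : DenseHom A} (h : Agree φ φ') :
    Agree (comp φ ψ) (comp φ' ψ) := by
  rintro d ⟨h₁, h₁'⟩ ⟨h₂, h₂'⟩
  exact h _ h₁' h₂'

end DenseHom

/-- The maximal ring of quotients of `A`: the direct limit of the modules `Hom(D, A)` over all
rationally dense ideals `D`, with composition as multiplication. -/
def MaxRingOfQuotients (A : Type*) [CommRing A] : Type _ :=
  Quotient (DenseHom.setoid A)

namespace MaxRingOfQuotients

variable {A : Type*} [CommRing A]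

/-- The class of an element of `Hom(D, A)`. -/
def mk (φ : DenseHom A) : MaxRingOfQuotients A := Quotient.mk _ φ

instance : Zero (MaxRingOfQuotients A) := ⟨mk (DenseHom.const 0)⟩

instance : One (MaxRingOfQuotients A) := ⟨mk (DenseHom.const 1)⟩

instance : Neg (MaxRingOfQuotients A) :=
  ⟨Quotient.map DenseHom.neg fun _ _ h d h₁ h₂ => congrArg Neg.neg (h d h₁ h₂)⟩

instance : Add (MaxRingOfQuotients A) :=
  ⟨Quotient.map₂ DenseHom.add fun _ _ h _ _ k d h₁ h₂ =>
    congrArg₂ (· + ·) (h d h₁.1 h₂.1) (k d h₁.2 h₂.2)⟩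

instance : Mul (MaxRingOfQuotients A) :=
  ⟨Quotient.map₂ DenseHom.comp fun _ _ h _ _ k =>
    (DenseHom.setoid A).trans (DenseHom.comp_congr_left h) (DenseHom.comp_congr_right k)⟩

theorem mul_comm_aux (p q : MaxRingOfQuotients A) : p * q = q * p := by
  induction p using Quotient.inductionOn
  induction q using Quotient.inductionOn
  exact Quotient.sound (DenseHom.comp_comm _ _)

theorem one_mul_aux (p : MaxRingOfQuotients A) : 1 * p = p := by
  induction p using Quotient.inductionOn
  refine Quotient.sound fun d h₁ h₂ => ?_
  exact one_mul _

theorem zero_mul_aux (p : MaxRingOfQuotients A) : 0 * p = 0 := by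
  induction p using Quotient.inductionOn
  refine Quotient.sound fun d h₁ h₂ => ?_
  exact (zero_mul _).trans (zero_mul _).symm

theorem mul_add_aux (p q r : MaxRingOfQuotients A) : p * (q + r) = p * q + p * r := by
  induction p using Quotient.inductionOn with | _ φ
  induction q using Quotient.inductionOn
  induction r using Quotient.inductionOn
  refine Quotient.sound fun d h₁ h₂ => ?_
  exact φ.map.map_add ⟨_, h₂.1.2⟩ ⟨_, h₂.2.2⟩

instance : CommRing (MaxRingOfQuotients A) where
  add_assoc p q r := by
    induction p using Quotient.inductionOn
    induction q using Quotient.inductionOn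
    induction r using Quotient.inductionOn
    exact Quotient.sound fun d h₁ h₂ => add_assoc _ _ _
  zero_add p := by
    induction p using Quotient.inductionOn
    refine Quotient.sound fun d h₁ h₂ => ?_
    exact (congrArg (· + _) (zero_mul d)).trans (zero_add _)
  add_zero p := by
    induction p using Quotient.inductionOn
    refine Quotient.sound fun d h₁ h₂ => ?_
    exact (congrArg (_ + ·) (zero_mul d)).trans (add_zero _)
  add_comm p q := by
    induction p using Quotient.inductionOn
    induction q using Quotient.inductionOn
    exact Quotient.sound fun d h₁ h₂ => add_comm _ _
  neg_add_cancel p := by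
    induction p using Quotient.inductionOn
    refine Quotient.sound fun d h₁ h₂ => ?_
    exact (neg_add_cancel _).trans (zero_mul d).symm
  mul_assoc p q r := by
    induction p using Quotient.inductionOn
    induction q using Quotient.inductionOn
    induction r using Quotient.inductionOn
    exact Quotient.sound fun d h₁ h₂ => rfl
  mul_comm := mul_comm_aux
  one_mul := one_mul_aux
  mul_one p := (mul_comm_aux p 1).trans (one_mul_aux p)
  zero_mul := zero_mul_aux
  mul_zero p := (mul_comm_aux p 0).trans (zero_mul_aux p)
  left_distrib := mul_add_aux
  right_distrib p q r := by
    rw [mul_comm_aux, mul_add_aux, mul_comm_aux r p, mul_comm_aux r q]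
  nsmul := nsmulRec
  zsmul := zsmulRec

end MaxRingOfQuotients

/-! ## Rings of continuous functions on a filter base of dense sets -/

/-- A nonempty family of dense subsets of `X`, closed under finite intersection. -/
structure DenseFilterBase (X : Type*) [TopologicalSpace X] where
  sets : Set (Set X)
  nonempty : sets.Nonempty
  dense : ∀ S ∈ sets, Dense S
  inter : ∀ S ∈ sets, ∀ T ∈ sets, S ∩ T ∈ sets

/-- A continuous real function on some member `dom` of the family. It is given by a function on
`X` that is continuous on `dom`; its values outside `dom` are disregarded. -/
structure RealPartialFun {X : Type*} [TopologicalSpace X] (𝒮 : DenseFilterBase X) where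
  dom : Set X
  mem : dom ∈ 𝒮.sets
  toFun : X → ℝ
  cont : ContinuousOn toFun dom

theorem eqOn_of_dense {X : Type*} [TopologicalSpace X] {S T : Set X} {f g : X → ℝ}
    (hT : Dense T) (hTS : T ⊆ S) (hf : ContinuousOn f S) (hg : ContinuousOn g S)
    (h : EqOn f g T) : EqOn f g S :=
  h.of_subset_closure hf hg hTS fun x _ => hT x

namespace RealPartialFun

variable {X : Type*} [TopologicalSpace X] {𝒮 : DenseFilterBase X}

/-- Two functions are identified when they agree on the intersection of their domains. -/
instance setoid (𝒮 : DenseFilterBase X) : Setoid (RealPartialFun 𝒮) where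
  r f g := EqOn f.toFun g.toFun (f.dom ∩ g.dom)
  iseqv :=
    { refl := fun _ _ _ => rfl
      symm := fun h _ hx => (h hx.symm).symm
      trans := by
        intro f g k h₁ h₂
        refine eqOn_of_dense (T := (f.dom ∩ k.dom) ∩ g.dom)
          (𝒮.dense _ (𝒮.inter _ (𝒮.inter _ f.mem _ k.mem) _ g.mem)) inter_subset_left
          (f.cont.mono inter_subset_left) (k.cont.mono inter_subset_right) ?_
        rintro x ⟨⟨hf, hk⟩, hg⟩
        exact (h₁ ⟨hf, hg⟩).trans (h₂ ⟨hg, hk⟩) }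

def const (𝒮 : DenseFilterBase X) (c : ℝ) : RealPartialFun 𝒮 where
  dom := 𝒮.nonempty.choose
  mem := 𝒮.nonempty.choose_spec
  toFun := fun _ => c
  cont := continuousOn_const

def add (f g : RealPartialFun 𝒮) : RealPartialFun 𝒮 where
  dom := f.dom ∩ g.dom
  mem := 𝒮.inter _ f.mem _ g.mem
  toFun := fun x => f.toFun x + g.toFun x
  cont := (f.cont.mono inter_subset_left).add (g.cont.mono inter_subset_right)

def mul (f g : RealPartialFun 𝒮) : RealPartialFun 𝒮 where
  dom := f.dom ∩ g.dom
  mem := 𝒮.inter _ f.mem _ g.mem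
  toFun := fun x => f.toFun x * g.toFun x
  cont := (f.cont.mono inter_subset_left).mul (g.cont.mono inter_subset_right)

def neg (f : RealPartialFun 𝒮) : RealPartialFun 𝒮 where
  dom := f.dom
  mem := f.mem
  toFun := fun x => -f.toFun x
  cont := f.cont.neg

end RealPartialFun

/-- The direct limit `C[𝒮]` of the rings `C(S)`, `S ∈ 𝒮`: all continuous real functions on
members of `𝒮`, modulo agreement on the intersection of the domains. -/
def ContLimit {X : Type*} [TopologicalSpace X] (𝒮 : DenseFilterBase X) : Type _ :=
  Quotient (RealPartialFun.setoid 𝒮)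

namespace ContLimit

variable {X : Type*} [TopologicalSpace X] {𝒮 : DenseFilterBase X}

/-- The class of a continuous function on a member of `𝒮`. -/
def mk (f : RealPartialFun 𝒮) : ContLimit 𝒮 := Quotient.mk _ f

instance : Zero (ContLimit 𝒮) := ⟨mk (RealPartialFun.const 𝒮 0)⟩

instance : One (ContLimit 𝒮) := ⟨mk (RealPartialFun.const 𝒮 1)⟩

instance : Neg (ContLimit 𝒮) :=
  ⟨Quotient.map RealPartialFun.neg fun _ _ h _ hx => congrArg Neg.neg (h hx)⟩

instance : Add (ContLimit 𝒮) :=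
  ⟨Quotient.map₂ RealPartialFun.add fun _ _ h _ _ k _ hx =>
    congrArg₂ (· + ·) (h ⟨hx.1.1, hx.2.1⟩) (k ⟨hx.1.2, hx.2.2⟩)⟩

instance : Mul (ContLimit 𝒮) :=
  ⟨Quotient.map₂ RealPartialFun.mul fun _ _ h _ _ k _ hx =>
    congrArg₂ (· * ·) (h ⟨hx.1.1, hx.2.1⟩) (k ⟨hx.1.2, hx.2.2⟩)⟩

instance : CommRing (ContLimit 𝒮) where
  add_assoc p q r := by
    induction p using Quotient.inductionOn
    induction q using Quotient.inductionOn
    induction r using Quotient.inductionOn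
    exact Quotient.sound fun x _ => add_assoc _ _ _
  zero_add p := by
    induction p using Quotient.inductionOn
    exact Quotient.sound fun x _ => zero_add _
  add_zero p := by
    induction p using Quotient.inductionOn
    exact Quotient.sound fun x _ => add_zero _
  add_comm p q := by
    induction p using Quotient.inductionOn
    induction q using Quotient.inductionOn
    exact Quotient.sound fun x _ => add_comm _ _
  neg_add_cancel p := by
    induction p using Quotient.inductionOn
    exact Quotient.sound fun x _ => neg_add_cancel _
  mul_assoc p q r := by
    induction p using Quotient.inductionOn
    induction q using Quotient.inductionOn
    induction r using Quotient.inductionOn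
    exact Quotient.sound fun x _ => mul_assoc _ _ _
  mul_comm p q := by
    induction p using Quotient.inductionOn
    induction q using Quotient.inductionOn
    exact Quotient.sound fun x _ => mul_comm _ _
  one_mul p := by
    induction p using Quotient.inductionOn
    exact Quotient.sound fun x _ => one_mul _
  mul_one p := by
    induction p using Quotient.inductionOn
    exact Quotient.sound fun x _ => mul_one _
  zero_mul p := by
    induction p using Quotient.inductionOn
    exact Quotient.sound fun x _ => zero_mul _
  mul_zero p := by
    induction p using Quotient.inductionOn
    exact Quotient.sound fun x _ => mul_zero _
  left_distrib p q r := by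
    induction p using Quotient.inductionOn
    induction q using Quotient.inductionOn
    induction r using Quotient.inductionOn
    exact Quotient.sound fun x _ => mul_add _ _ _
  right_distrib p q r := by
    induction p using Quotient.inductionOn
    induction q using Quotient.inductionOn
    induction r using Quotient.inductionOn
    exact Quotient.sound fun x _ => add_mul _ _ _
  nsmul := nsmulRec
  zsmul := zsmulRec

end ContLimit

/-! ### The natural metric -/

/-- The bounded increasing function `r ↦ |r| / (1 + |r|)`. -/
def trunc (r : ℝ) : ℝ := |r| / (1 + |r|)

theorem trunc_nonneg (r : ℝ) : 0 ≤ trunc r := by unfold trunc; positivity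

theorem trunc_le_one (r : ℝ) : trunc r ≤ 1 := by
  unfold trunc
  rw [div_le_one (by positivity)]
  linarith

theorem trunc_continuous : Continuous trunc := by
  unfold trunc
  exact continuous_abs.div (continuous_const.add continuous_abs) fun r => by positivity

theorem trunc_eq_zero {r : ℝ} (h : trunc r = 0) : r = 0 := by
  unfold trunc at h
  rcases div_eq_zero_iff.mp h with h | h
  · exact abs_eq_zero.mp h
  · have := abs_nonneg r
    linarith

theorem trunc_add_le (r s : ℝ) : trunc (r + s) ≤ trunc r + trunc s := by
  unfold trunc
  have hr := abs_nonneg r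
  have hs := abs_nonneg s
  have h := abs_add_le r s
  have h0 := abs_nonneg (r + s)
  calc |r + s| / (1 + |r + s|) ≤ (|r| + |s|) / (1 + (|r| + |s|)) := by
        rw [div_le_div_iff₀ (by positivity) (by positivity)]
        nlinarith
    _ = |r| / (1 + (|r| + |s|)) + |s| / (1 + (|r| + |s|)) := add_div _ _ _
    _ ≤ |r| / (1 + |r|) + |s| / (1 + |s|) := by
        gcongr <;> linarith

/-- The supremum of `|f| / (1 + |f|)` over `S`. -/
def truncSup {X : Type*} (f : X → ℝ) (S : Set X) : ℝ := ⨆ x : S, trunc (f x)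

theorem bddAbove_trunc {X : Type*} (f : X → ℝ) (S : Set X) :
    BddAbove (range fun x : S => trunc (f x)) :=
  ⟨1, by rintro _ ⟨x, rfl⟩; exact trunc_le_one _⟩

theorem truncSup_nonneg {X : Type*} (f : X → ℝ) (S : Set X) : 0 ≤ truncSup f S :=
  Real.iSup_nonneg fun _ => trunc_nonneg _

theorem le_truncSup {X : Type*} (f : X → ℝ) {S : Set X} {x : X} (hx : x ∈ S) :
    trunc (f x) ≤ truncSup f S :=
  le_ciSup (bddAbove_trunc f S) ⟨x, hx⟩

theorem truncSup_le {X : Type*} {f : X → ℝ} {S : Set X} {c : ℝ} (hc : 0 ≤ c)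
    (h : ∀ x ∈ S, trunc (f x) ≤ c) : truncSup f S ≤ c :=
  Real.iSup_le (fun x => h x x.2) hc

theorem truncSup_congr {X : Type*} {f g : X → ℝ} {S : Set X} (h : EqOn f g S) :
    truncSup f S = truncSup g S :=
  iSup_congr fun x => by rw [h x.2]

/-- The supremum is determined by the values on any dense subset. -/
theorem truncSup_dense {X : Type*} [TopologicalSpace X] {f : X → ℝ} {S T : Set X}
    (hf : ContinuousOn f S) (hT : Dense T) (hTS : T ⊆ S) : truncSup f S = truncSup f T := by
  apply le_antisymm
  · refine truncSup_le (truncSup_nonneg _ _) fun x hx => ?_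
    have hc : ContinuousWithinAt (fun y => trunc (f y)) T x :=
      (trunc_continuous.comp_continuousOn hf x hx).mono hTS
    have : x ∈ closure T := hT x
    have hne : (𝓝[T] x).NeBot := mem_closure_iff_nhdsWithin_neBot.mp this
    refine le_of_tendsto hc ?_
    filter_upwards [self_mem_nhdsWithin] with y hy using le_truncSup f hy
  · exact truncSup_le (truncSup_nonneg _ _) fun x hx => le_truncSup f (hTS hx)

namespace ContLimit

variable {X : Type*} [TopologicalSpace X] {𝒮 : DenseFilterBase X}

/-- The supremum of `|f| / (1 + |f|)` over the domain of a representative `f`. -/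
def size : ContLimit 𝒮 → ℝ :=
  Quotient.lift (fun f : RealPartialFun 𝒮 => truncSup f.toFun f.dom) fun f g h => by
    have hd := 𝒮.dense _ (𝒮.inter _ f.mem _ g.mem)
    change truncSup f.toFun f.dom = truncSup g.toFun g.dom
    rw [truncSup_dense f.cont hd inter_subset_left, truncSup_dense g.cont hd inter_subset_right]
    exact truncSup_congr h

theorem size_mk (f : RealPartialFun 𝒮) : size (mk f) = truncSup f.toFun f.dom := rfl

theorem size_zero : size (0 : ContLimit 𝒮) = 0 := by
  refine le_antisymm (truncSup_le le_rfl fun x _ => ?_) (truncSup_nonneg _ _)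
  simp [RealPartialFun.const, trunc]

theorem size_neg (p : ContLimit 𝒮) : size (-p) = size p := by
  induction p using Quotient.inductionOn
  refine iSup_congr fun x => ?_
  simp [RealPartialFun.neg, trunc]

theorem size_add_le (p q : ContLimit 𝒮) : size (p + q) ≤ size p + size q := by
  induction p using Quotient.inductionOn
  induction q using Quotient.inductionOn
  refine truncSup_le (add_nonneg (truncSup_nonneg _ _) (truncSup_nonneg _ _)) fun x hx => ?_
  exact (trunc_add_le _ _).trans (add_le_add (le_truncSup _ hx.1) (le_truncSup _ hx.2))

theorem eq_zero_of_size (p : ContLimit 𝒮) (h : size p = 0) : p = 0 := by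
  induction p using Quotient.inductionOn with | _ f
  refine Quotient.sound fun x hx => trunc_eq_zero (le_antisymm ?_ (trunc_nonneg _))
  exact (le_truncSup f.toFun hx.1).trans h.le

/-- The distance of `f` and `g` is the supremum norm of `|f - g| / (1 + |f - g|)`. -/
instance : MetricSpace (ContLimit 𝒮) where
  dist p q := size (p - q)
  dist_self p := by simp [size_zero]
  dist_comm p q := by rw [← size_neg, neg_sub]
  dist_triangle p q r := by
    have := size_add_le (p - q) (q - r)
    rwa [sub_add_sub_cancel] at this
  eq_of_dist_eq_zero h := sub_eq_zero.mp (eq_zero_of_size _ h)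

/-- The inclusion of `C[𝒮]` in `C[𝒯]` for `𝒮 ⊆ 𝒯`. -/
def incl {𝒮 𝒯 : DenseFilterBase X} (h : 𝒮.sets ⊆ 𝒯.sets) : ContLimit 𝒮 → ContLimit 𝒯 :=
  Quotient.map (fun f => ⟨f.dom, h f.mem, f.toFun, f.cont⟩) fun _ _ hfg => hfg

end ContLimit

/-! ## Dense open sets and dense `G_δ` sets -/

/-- All dense open sets. -/
def denseOpens (X : Type*) [TopologicalSpace X] : DenseFilterBase X where
  sets := {V | IsOpen V ∧ Dense V}
  nonempty := ⟨univ, isOpen_univ, dense_univ⟩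
  dense _ h := h.2
  inter _ hS _ hT := ⟨hS.1.inter hT.1, hS.2.inter_of_isOpen_left hT.2 hS.1⟩

/-- All dense `G_δ` sets of a Baire space. -/
def denseGδs (X : Type*) [TopologicalSpace X] [BaireSpace X] : DenseFilterBase X where
  sets := {S | IsGδ S ∧ Dense S}
  nonempty := ⟨univ, isOpen_univ.isGδ, dense_univ⟩
  dense _ h := h.2
  inter _ hS _ hT := ⟨hS.1.inter hT.1, hS.2.inter_of_Gδ hS.1 hT.1 hT.2⟩

theorem denseOpens_subset_denseGδs (X : Type*) [TopologicalSpace X] [BaireSpace X] :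
    (denseOpens X).sets ⊆ (denseGδs X).sets := fun _ h => ⟨h.1.isGδ, h.2⟩

/-- Restriction to `X` of the continuous functions on dense open subsets of `βX`. -/
def restrictStoneCech (X : Type*) [TopologicalSpace X] [T35Space X] :
    ContLimit (denseOpens (StoneCech X)) → ContLimit (denseOpens X) :=
  Quotient.map
    (fun f =>
      { dom := stoneCechUnit ⁻¹' f.dom
        mem := by
          refine ⟨f.mem.1.preimage continuous_stoneCechUnit, ?_⟩
          have hi := (isDenseInducing_stoneCechUnit (X := X))
          rw [dense_iff_inter_open]
          intro U hU hne
          obtain ⟨W, hW, rfl⟩ := hi.isInducing.isOpen_iff.mp hU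
          obtain ⟨x, hx⟩ := hne
          obtain ⟨_, hy, z, rfl⟩ := hi.dense.inter_open_nonempty (W ∩ f.dom) (hW.inter f.mem.1)
            (f.mem.2.inter_open_nonempty W hW ⟨_, hx⟩)
          exact ⟨z, hy⟩
        toFun := fun x => f.toFun (stoneCechUnit x)
        cont := f.cont.comp continuous_stoneCechUnit.continuousOn fun _ hx => hx })
    fun _ _ h _ hx => h hx

/-! ## The ring `Q(X)` -/

/-- `Q(X)` is the maximal ring of quotients of `C(X)`. -/
abbrev QRing (X : Type*) [TopologicalSpace X] : Type _ := MaxRingOfQuotients C(X, ℝ)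

section Realize

variable {X : Type*} [TopologicalSpace X]

/-- The set of points at which some member of the ideal `D` does not vanish. -/
def coz (D : Ideal C(X, ℝ)) : Set X := {x | ∃ d ∈ D, d x ≠ 0}

theorem isOpen_coz (D : Ideal C(X, ℝ)) : IsOpen (coz D) := by
  have : coz D = ⋃ d ∈ D, {x | d x ≠ 0} := by ext; simp [coz]
  rw [this]
  exact isOpen_biUnion fun d _ => isOpen_ne_fun d.continuous continuous_const

theorem dense_coz [T35Space X] {D : Ideal C(X, ℝ)} (hD : IsRatDense D) : Dense (coz D) := by
  intro x
  by_contra hx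
  obtain ⟨f, hf, hfx, hfK⟩ :=
    CompletelyRegularSpace.completely_regular x (closure (coz D)) isClosed_closure hx
  let g : C(X, ℝ) := ⟨fun y => 1 - (f y : ℝ), by fun_prop⟩
  have hg : g = 0 := by
    refine hD g fun d hd => ?_
    ext y
    by_cases hy : d y = 0
    · simp [hy]
    · have : f y = 1 := hfK (subset_closure ⟨d, hd, hy⟩)
      simp [g, this]
  have h1 : g x = 1 := by simp [g, hfx]
  rw [hg] at h1
  simp at h1

open Classical in
/-- The function `x ↦ φ(d)(x) / d(x)` on `coz D`, where `d ∈ D` is any element with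
`d(x) ≠ 0`. -/
def realizeFun (φ : DenseHom C(X, ℝ)) (x : X) : ℝ :=
  if h : ∃ d : φ.dom, (d : C(X, ℝ)) x ≠ 0 then
    φ.map h.choose x / (h.choose : C(X, ℝ)) x
  else 0

theorem realizeFun_eq (φ : DenseHom C(X, ℝ)) (d : φ.dom) {x : X}
    (hx : (d : C(X, ℝ)) x ≠ 0) : realizeFun φ x = φ.map d x / (d : C(X, ℝ)) x := by
  have h : ∃ d : φ.dom, (d : C(X, ℝ)) x ≠ 0 := ⟨d, hx⟩
  rw [realizeFun, dif_pos h, div_eq_div_iff h.choose_spec hx]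
  exact DFunLike.congr_fun (φ.map_mul_comm h.choose d) x

theorem realizeFun_continuousOn (φ : DenseHom C(X, ℝ)) :
    ContinuousOn (realizeFun φ) (coz φ.dom) := by
  rintro x ⟨d, hd, hx⟩
  apply ContinuousAt.continuousWithinAt
  have h1 : ContinuousAt (fun y => φ.map ⟨d, hd⟩ y / d y) x :=
    (φ.map ⟨d, hd⟩).continuous.continuousAt.div d.continuous.continuousAt hx
  refine h1.congr ?_
  filter_upwards [(isOpen_ne_fun d.continuous continuous_const).mem_nhds hx] with y hy
  exact (realizeFun_eq φ ⟨d, hd⟩ hy).symm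

theorem realizeFun_agree {φ ψ : DenseHom C(X, ℝ)} (h : φ.Agree ψ) :
    EqOn (realizeFun φ) (realizeFun ψ) (coz φ.dom ∩ coz ψ.dom) := by
  rintro x ⟨⟨d, hd, hdx⟩, ⟨e, he, hex⟩⟩
  have p₁ := φ.dom.mul_mem_right e hd
  have p₂ := ψ.dom.mul_mem_left d he
  have hx : (d * e) x ≠ 0 := mul_ne_zero hdx hex
  rw [realizeFun_eq φ ⟨_, p₁⟩ hx, realizeFun_eq ψ ⟨_, p₂⟩ hx, h _ p₁ p₂]

/-- An element of `Hom(D, C(X))` acts on `D` as multiplication by a continuous function on the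
dense open set `coz D`; this is the resulting map from `Q(X)` to the ring of continuous functions
on dense open sets. -/
def realize [T35Space X] : QRing X → ContLimit (denseOpens X) :=
  Quotient.map
    (fun φ =>
      { dom := coz φ.dom
        mem := ⟨isOpen_coz _, dense_coz φ.dense⟩
        toFun := realizeFun φ
        cont := realizeFun_continuousOn φ })
    fun _ _ h => realizeFun_agree h

theorem realize_injective [T35Space X] : Function.Injective (realize (X := X)) := by
  intro p q
  induction p using Quotient.inductionOn with | _ φ
  induction q using Quotient.inductionOn with | _ ψ
  intro h
  have h' : EqOn (realizeFun φ) (realizeFun ψ) (coz φ.dom ∩ coz ψ.dom) := Quotient.exact h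
  refine Quotient.sound fun d h₁ h₂ => ?_
  have key : ∀ (χ : DenseHom C(X, ℝ)) (hd : d ∈ χ.dom), ∀ x ∈ coz χ.dom,
      χ.map ⟨d, hd⟩ x = realizeFun χ x * d x := by
    rintro χ hd x ⟨e, he, hx⟩
    rw [realizeFun_eq χ ⟨e, he⟩ hx, div_mul_eq_mul_div, eq_div_iff hx]
    exact DFunLike.congr_fun (χ.map_mul_comm ⟨d, hd⟩ ⟨e, he⟩) x
  have hdense : Dense (coz φ.dom ∩ coz ψ.dom) :=
    (dense_coz φ.dense).inter_of_isOpen_left (dense_coz ψ.dense) (isOpen_coz _)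
  refine DFunLike.coe_injective (Continuous.ext_on hdense (ContinuousMap.continuous _)
    (ContinuousMap.continuous _) fun x hx => ?_)
  rw [key φ h₁ x hx.1, key ψ h₂ x hx.2, h' hx]

/-- The natural metric of `Q(X)`, whose elements are regarded as continuous functions on dense
open sets: the supremum norm of `|f - g| / (1 + |f - g|)`. -/
instance [T35Space X] : MetricSpace (QRing X) :=
  MetricSpace.induced realize realize_injective inferInstance

end Realize

end

/-!
The elements of `Q(X)` are exactly the continuous functions on dense open subsets of `X`, up to
agreement: a continuous `f` on a dense open `V` is multiplication by `f` on the ideal of all `d`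
for which `d * f` extends continuously to `X`, and complete regularity provides enough such `d`.
For bounded `d` and `d * f` both extend to `βX`, so the same argument shows that `f` extends to a
dense open subset of `βX`, and `X` and `βX` have the same continuous functions on dense open sets.

It remains to see that `C[𝒢₀]` is the completion of `C[𝒱₀]` over a Baire space. It is complete,
because a Cauchy sequence converges uniformly on the intersection of countably many domains.
And `C[𝒱₀]` is dense in it: if a function `f` on a dense set takes values within `ε` of `c n` on
the trace of the open set `U n`, and the `U n` together cover that set, then `x ↦ c (m x)`, where
`m x` is the least index with `x ∈ U (m x)`, is locally constant on a dense open set and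
approximates `f` there.
-/

noncomputable section

open Filter TopologicalSpace UniformSpace
open scoped BoundedContinuousFunction

theorem exists_completion_isometryEquiv {α β : Type*} [PseudoMetricSpace α] [MetricSpace β]
    [CompleteSpace β] {f : α → β} (hf : Isometry f) (hd : DenseRange f) :
    ∃ e : Completion α ≃ᵢ β, ∀ a : α, e (a : Completion α) = f a := by
  have hext : Isometry (Completion.extension f) := hf.completion_extension
  have hcoe : ∀ a : α, Completion.extension f (a : Completion α) = f a :=
    Completion.extension_coe hf.uniformContinuous
  have hrange : range f ⊆ range (Completion.extension f) := by
    rintro _ ⟨a, rfl⟩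
    exact ⟨a, hcoe a⟩
  have hdense : DenseRange (Completion.extension f) := hd.mono hrange
  have hsurj : Function.Surjective (Completion.extension f) := by
    rw [← range_eq_univ, ← hext.isClosedEmbedding.isClosed_range.closure_eq, hdense.closure_range]
  exact ⟨⟨Equiv.ofBijective _ ⟨hext.injective, hsurj⟩, hext⟩, hcoe⟩

theorem trunc_le_abs (r : ℝ) : trunc r ≤ |r| :=
  div_le_self (abs_nonneg r) (le_add_of_nonneg_right (abs_nonneg r))

theorem trunc_lt_trunc_iff {r s : ℝ} : trunc r < trunc s ↔ |r| < |s| := by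
  unfold trunc
  rw [div_lt_div_iff₀ (by positivity) (by positivity)]
  constructor <;> intro h <;> linarith

theorem truncSup_image {X Y : Type*} (f : Y → ℝ) (i : X → Y) (S : Set X) :
    truncSup f (i '' S) = truncSup (f ∘ i) S :=
  (imageFactorization_surjective.iSup_comp fun y : i '' S => trunc (f y)).symm

theorem trunc_pos {r : ℝ} (hr : r ≠ 0) : 0 < trunc r :=
  div_pos (abs_pos.mpr hr) (by positivity)

namespace ContLimit

variable {X Y : Type*} [TopologicalSpace X] [TopologicalSpace Y]
  {𝒮 𝒯 : DenseFilterBase X} {𝒰 : DenseFilterBase Y}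

theorem dist_eq_size (p q : ContLimit 𝒮) : dist p q = size (p - q) := rfl

theorem dist_mk_mk (f g : RealPartialFun 𝒮) :
    dist (mk f) (mk g) = truncSup (fun x => f.toFun x - g.toFun x) (f.dom ∩ g.dom) := by
  simp only [sub_eq_add_neg]
  rw [dist_eq_size, sub_eq_add_neg]
  rfl

theorem trunc_sub_le_dist (f g : RealPartialFun 𝒮) {x : X} (hf : x ∈ f.dom) (hg : x ∈ g.dom) :
    trunc (f.toFun x - g.toFun x) ≤ dist (mk f) (mk g) := by
  rw [dist_mk_mk]
  exact le_truncSup (fun x => f.toFun x - g.toFun x) ⟨hf, hg⟩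

theorem dist_mk_le {f g : RealPartialFun 𝒮} {ε : ℝ} (hε : 0 ≤ ε)
    (h : ∀ x ∈ f.dom ∩ g.dom, dist (f.toFun x) (g.toFun x) ≤ ε) : dist (mk f) (mk g) ≤ ε := by
  rw [dist_mk_mk]
  exact truncSup_le hε fun x hx => (trunc_le_abs _).trans (h x hx)

theorem isometry_of_size_map (F : ContLimit 𝒮 →+* ContLimit 𝒰)
    (hF : ∀ p, size (F p) = size p) : Isometry F :=
  Isometry.of_dist_eq fun p q => by rw [dist_eq_size, dist_eq_size, ← map_sub, hF]

/-- The inclusion of `C[𝒮]` in `C[𝒯]` as a ring homomorphism. -/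
def inclHom (h : 𝒮.sets ⊆ 𝒯.sets) : ContLimit 𝒮 →+* ContLimit 𝒯 where
  toFun := incl h
  map_zero' := Quotient.sound fun _ _ => rfl
  map_one' := Quotient.sound fun _ _ => rfl
  map_add' p q := by
    induction p, q using Quotient.inductionOn₂
    rfl
  map_mul' p q := by
    induction p, q using Quotient.inductionOn₂
    rfl

theorem isometry_incl (h : 𝒮.sets ⊆ 𝒯.sets) : Isometry (incl h) :=
  isometry_of_size_map (inclHom h) fun p => by
    induction p using Quotient.inductionOn
    rfl

/-! ### Completeness -/

theorem uniformCauchySeqOn_of_cauchySeq_mk {f : ℕ → RealPartialFun 𝒮}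
    (hf : CauchySeq fun n => mk (f n)) :
    UniformCauchySeqOn (fun n => (f n).toFun) atTop (⋂ n, (f n).dom) := by
  rw [Metric.uniformCauchySeqOn_iff]
  intro ε hε
  obtain ⟨N, hN⟩ := Metric.cauchySeq_iff.mp hf (trunc ε) (trunc_pos hε.ne')
  refine ⟨N, fun m hm n hn x hx => ?_⟩
  have hdom : ∀ n, x ∈ (f n).dom := mem_iInter.mp hx
  rw [Real.dist_eq, ← abs_of_pos hε, ← trunc_lt_trunc_iff]
  exact (trunc_sub_le_dist (f m) (f n) (hdom m) (hdom n)).trans_lt (hN m hm n hn)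

theorem tendsto_mk_of_tendstoUniformlyOn {ι : Type*} {l : Filter ι} {f : ι → RealPartialFun 𝒮}
    {g : RealPartialFun 𝒮} (h : TendstoUniformlyOn (fun i => (f i).toFun) g.toFun l g.dom) :
    Tendsto (fun i => mk (f i)) l (𝓝 (mk g)) := by
  refine Metric.tendsto_nhds.mpr fun ε hε => ?_
  filter_upwards [Metric.tendstoUniformlyOn_iff.mp h (ε / 2) (half_pos hε)] with i hi
  rw [dist_comm]
  exact (dist_mk_le (half_pos hε).le fun x hx => (hi x hx.1).le).trans_lt (half_lt_self hε)

theorem completeSpace_of_iInter_mem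
    (h𝒮 : ∀ S : ℕ → Set X, (∀ n, S n ∈ 𝒮.sets) → ⋂ n, S n ∈ 𝒮.sets) :
    CompleteSpace (ContLimit 𝒮) := by
  refine Metric.complete_of_cauchySeq_tendsto fun u hu => ?_
  obtain ⟨f, rfl⟩ : ∃ f : ℕ → RealPartialFun 𝒮, (fun n => mk (f n)) = u :=
    ⟨fun n => (u n).out, funext fun n => (u n).out_eq⟩
  have hcauchy := uniformCauchySeqOn_of_cauchySeq_mk hu
  have hlim : TendstoUniformlyOn (fun n => (f n).toFun)
      (fun x => limUnder atTop fun n => (f n).toFun x) atTop (⋂ n, (f n).dom) :=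
    hcauchy.tendstoUniformlyOn_of_tendsto fun x hx =>
      CauchySeq.tendsto_limUnder (hcauchy.cauchySeq hx)
  have hcont := hlim.continuousOn <| Frequently.of_forall fun n =>
    (f n).cont.mono (iInter_subset _ n)
  exact ⟨mk ⟨_, h𝒮 _ fun n => (f n).mem, _, hcont⟩, tendsto_mk_of_tendstoUniformlyOn hlim⟩

instance [BaireSpace X] : CompleteSpace (ContLimit (denseGδs X)) :=
  completeSpace_of_iInter_mem fun _ hS =>
    ⟨.iInter fun n => (hS n).1, dense_iInter_of_Gδ (fun n => (hS n).1) fun n => (hS n).2⟩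

end ContLimit

/-! ### Approximation by functions on dense open sets -/

theorem exists_isOpen_dense_continuousOn_index {X : Type*} [TopologicalSpace X] {U : ℕ → Set X}
    (hU : ∀ n, IsOpen (U n)) (hd : Dense (⋃ n, U n)) :
    ∃ (V : Set X) (m : X → ℕ), IsOpen V ∧ Dense V ∧ ContinuousOn m V ∧ ∀ x ∈ V, x ∈ U (m x) := by
  classical
  let W : ℕ → Set X := fun n => U n \ closure (⋃ k < n, U k)
  let m : X → ℕ := fun x => sInf {n | x ∈ U n}
  have hW : ∀ n, IsOpen (W n) := fun n => (hU n).sdiff isClosed_closure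
  have hm : ∀ {n}, EqOn m (fun _ => n) (W n) := fun {n} x hx =>
    IsLeast.csInf_eq ⟨hx.1, fun k hk => not_lt.mp fun hkn =>
      hx.2 (subset_closure (mem_biUnion hkn hk))⟩
  refine ⟨⋃ n, W n, m, isOpen_iUnion hW, dense_iff_inter_open.mpr fun O hO hne => ?_, ?_, ?_⟩
  · have hmeet : ∃ n, (O ∩ U n).Nonempty := by
      simpa only [inter_iUnion, nonempty_iUnion] using hd.inter_open_nonempty O hO hne
    obtain ⟨x, hxO, hxU⟩ := Nat.find_spec hmeet
    have hdisj : Disjoint O (⋃ k < Nat.find hmeet, U k) :=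
      disjoint_iUnion₂_right.mpr fun k hk =>
        disjoint_iff_inter_eq_empty.mpr (not_nonempty_iff_eq_empty.mp (Nat.find_min hmeet hk))
    exact ⟨x, hxO, mem_iUnion.mpr ⟨_, hxU, (hdisj.closure_right hO).notMem_of_mem_left hxO⟩⟩
  · exact ContinuousOn.iUnion_of_isOpen (fun n => continuousOn_const.congr hm) hW
  · intro x hx
    obtain ⟨n, hn⟩ := mem_iUnion.mp hx
    rw [hm hn]
    exact hn.1

theorem exists_isOpen_dense_continuousOn_dist_lt {X E : Type*} [TopologicalSpace X]
    [PseudoMetricSpace E] [SeparableSpace E] [Nonempty E] {f : X → E} {S : Set X}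
    (hf : ContinuousOn f S) (hS : Dense S) {ε : ℝ} (hε : 0 < ε) :
    ∃ (V : Set X) (g : X → E), IsOpen V ∧ Dense V ∧ ContinuousOn g V ∧
      ∀ x ∈ V ∩ S, dist (f x) (g x) < ε := by
  choose U hUo hU using fun n =>
    continuousOn_iff'.mp hf (Metric.ball (denseSeq E n) ε) Metric.isOpen_ball
  have hcover : S ⊆ ⋃ n, U n := fun x hx => by
    obtain ⟨n, hn⟩ := (denseRange_denseSeq E).exists_dist_lt (f x) hε
    have hxU : x ∈ U n ∩ S := hU n ▸ ⟨hn, hx⟩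
    exact mem_iUnion.mpr ⟨n, hxU.1⟩
  obtain ⟨V, m, hVo, hVd, hm, hmU⟩ :=
    exists_isOpen_dense_continuousOn_index hUo (hS.mono hcover)
  refine ⟨V, denseSeq E ∘ m, hVo, hVd,
    continuous_of_discreteTopology.comp_continuousOn hm, fun x hx => ?_⟩
  have hxS : x ∈ U (m x) ∩ S := ⟨hmU x hx.1, hx.2⟩
  rw [← hU] at hxS
  exact hxS.1

theorem ContLimit.denseRange_incl_denseOpens (X : Type*) [TopologicalSpace X] [BaireSpace X] :
    DenseRange (incl (denseOpens_subset_denseGδs X)) := by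
  refine Metric.denseRange_iff.mpr fun p ε hε => ?_
  induction p using Quotient.inductionOn with | _ f
  obtain ⟨V, g, hVo, hVd, hg, hfg⟩ :=
    exists_isOpen_dense_continuousOn_dist_lt f.cont f.mem.2 (half_pos hε)
  exact ⟨mk ⟨V, ⟨hVo, hVd⟩, g, hg⟩,
    (dist_mk_le (half_pos hε).le fun x hx => (hfg x ⟨hx.2, hx.1⟩).le).trans_lt (half_lt_self hε)⟩

theorem exists_completion_isometryEquiv_denseGδs {α Y : Type*} [PseudoMetricSpace α]
    [TopologicalSpace Y] [BaireSpace Y] {F : α → ContLimit (denseOpens Y)}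
    (hF : Isometry F) (hsurj : Function.Surjective F) :
    ∃ e : Completion α ≃ᵢ ContLimit (denseGδs Y),
      ∀ a : α, e (a : Completion α) = ContLimit.incl (denseOpens_subset_denseGδs Y) (F a) :=
  have hincl := ContLimit.isometry_incl (denseOpens_subset_denseGδs Y)
  exists_completion_isometryEquiv (hincl.comp hF) <|
    (ContLimit.denseRange_incl_denseOpens Y).comp hsurj.denseRange hincl.continuous

/-! ### The ring `Q(X)` and functions on dense open sets -/

section Realize

variable {X : Type*} [TopologicalSpace X]

theorem DenseHom.map_apply_eq (φ : DenseHom C(X, ℝ)) {d : C(X, ℝ)} (hd : d ∈ φ.dom) {x : X}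
    (hx : x ∈ coz φ.dom) : φ.map ⟨d, hd⟩ x = realizeFun φ x * d x := by
  obtain ⟨e, he, hex⟩ := hx
  rw [realizeFun_eq φ ⟨e, he⟩ hex, div_mul_eq_mul_div, eq_div_iff hex]
  exact DFunLike.congr_fun (φ.map_mul_comm ⟨d, hd⟩ ⟨e, he⟩) x

theorem realizeFun_eq_of_map_eq (φ : DenseHom C(X, ℝ)) {x : X} {r : ℝ} (hx : x ∈ coz φ.dom)
    (h : ∀ d : φ.dom, φ.map d x = r * (d : C(X, ℝ)) x) : realizeFun φ x = r := by
  obtain ⟨d, hd, hdx⟩ := hx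
  rw [realizeFun_eq φ ⟨d, hd⟩ hdx, h, mul_div_cancel_right₀ _ hdx]

/-- The map `realize` from `Q(X)` to the continuous functions on dense open sets, as a ring
homomorphism. -/
def realizeHom (X : Type*) [TopologicalSpace X] [T35Space X] :
    QRing X →+* ContLimit (denseOpens X) where
  toFun := realize
  map_zero' := Quotient.sound fun _ hx => realizeFun_eq_of_map_eq _ hx.1 fun _ => rfl
  map_one' := Quotient.sound fun _ hx => realizeFun_eq_of_map_eq _ hx.1 fun _ => rfl
  map_add' p q := by
    induction p, q using Quotient.inductionOn₂ with | _ φ ψ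
    refine Quotient.sound fun x hx => realizeFun_eq_of_map_eq _ hx.1 fun d => ?_
    change φ.map ⟨d, d.2.1⟩ x + ψ.map ⟨d, d.2.2⟩ x = (realizeFun φ x + realizeFun ψ x) * _
    rw [φ.map_apply_eq d.2.1 hx.2.1, ψ.map_apply_eq d.2.2 hx.2.2, add_mul]
  map_mul' p q := by
    induction p, q using Quotient.inductionOn₂ with | _ φ ψ
    refine Quotient.sound fun x hx => realizeFun_eq_of_map_eq _ hx.1 fun d => ?_
    change φ.map ⟨ψ.map ⟨d, d.2.1⟩, d.2.2⟩ x = realizeFun φ x * realizeFun ψ x * _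
    rw [φ.map_apply_eq d.2.2 hx.2.1, ψ.map_apply_eq d.2.1 hx.2.2, mul_assoc]

theorem isometry_realize [T35Space X] : Isometry (realize (X := X)) :=
  Isometry.of_dist_eq fun _ _ => rfl

end Realize

/-! ### Extension along dense `C*`-embeddings -/

section CStarEmbedding

variable {X Y : Type*} [TopologicalSpace X] [TopologicalSpace Y] {i : X → Y}

/-- A continuous map with dense range along which all bounded continuous real functions extend.
If `X` is completely regular and Hausdorff, such a map is automatically an embedding, and `X` is
what is called a dense `C*`-embedded subspace of `Y`. -/
structure IsDenseCStarEmbedding (i : X → Y) : Prop where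
  continuous : Continuous i
  denseRange : DenseRange i
  exists_extension : ∀ f : X →ᵇ ℝ, ∃ g : C(Y, ℝ), ∀ x, g (i x) = f x

theorem isDenseCStarEmbedding_id : IsDenseCStarEmbedding (id : X → X) :=
  ⟨continuous_id, denseRange_id, fun f => ⟨f, fun _ => rfl⟩⟩

theorem isDenseCStarEmbedding_stoneCechUnit :
    IsDenseCStarEmbedding (stoneCechUnit : X → StoneCech X) := by
  refine ⟨continuous_stoneCechUnit, denseRange_stoneCechUnit, fun f => ?_⟩
  let f' : X → Metric.closedBall (0 : ℝ) ‖f‖ :=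
    fun x => ⟨f x, mem_closedBall_zero_iff.mpr (f.norm_coe_le_norm x)⟩
  have hf' : Continuous f' := f.continuous.subtype_mk _
  exact ⟨⟨_, continuous_subtype_val.comp (continuous_stoneCechExtend hf')⟩, fun x =>
    congrArg Subtype.val (stoneCechExtend_stoneCechUnit hf' x)⟩

theorem IsDenseCStarEmbedding.eq_of_eqOn {V : Set X} {g h : C(Y, ℝ)}
    (hi : IsDenseCStarEmbedding i) (hV : Dense V) (hgh : ∀ x ∈ V, g (i x) = h (i x)) : g = h :=
  DFunLike.coe_injective <| Continuous.ext_on (hi.denseRange.dense_image hi.continuous hV)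
    g.continuous h.continuous (forall_mem_image.mpr hgh)

theorem exists_tsupport_subset_apply_ne_zero [CompletelyRegularSpace X] {V : Set X}
    (hV : IsOpen V) {x : X} (hx : x ∈ V) : ∃ d : C(X, ℝ), tsupport d ⊆ V ∧ d x ≠ 0 := by
  obtain ⟨u, hu, hux, huV⟩ := CompletelyRegularSpace.completely_regular_isOpen x V hV hx
  have hu' : Continuous fun y => (u y : ℝ) := continuous_subtype_val.comp hu
  let d : C(X, ℝ) := ⟨fun y => max 0 (1 / 2 - (u y : ℝ)), by fun_prop⟩
  have hsupport : Function.support d ⊆ {y | (u y : ℝ) ≤ 1 / 2} := fun y hy => by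
    by_contra hlt
    exact hy (max_eq_left (by linarith [show (1 / 2 : ℝ) < u y from not_le.mp hlt]))
  refine ⟨d, (closure_minimal hsupport (isClosed_le hu' continuous_const)).trans fun y hy => ?_, ?_⟩
  · by_contra hyV
    have hy1 : (u y : ℝ) = 1 := congrArg Subtype.val (huV hyV)
    rw [mem_ofPred_eq, hy1] at hy
    norm_num at hy
  · simp [d, hux]

theorem exists_bounded_mul_eq_bounded [CompletelyRegularSpace X] {V : Set X} (hV : IsOpen V)
    {f : X → ℝ} (hf : ContinuousOn f V) {x : X} (hx : x ∈ V) :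
    ∃ d k : X →ᵇ ℝ, d x ≠ 0 ∧ ∀ y, k y = f y * d y := by
  obtain ⟨d, hdV, hdx⟩ := exists_tsupport_subset_apply_ne_zero hV hx
  let k : C(X, ℝ) := ⟨fun y => f y * d y,
    (hf.mul d.continuous.continuousOn).continuous_of_tsupport_subset hV
      (tsupport_mul_subset_right.trans hdV)⟩
  -- Division by `1 + d² + k²` makes both functions bounded and keeps their ratio `f`.
  have hpos : ∀ y, 0 < 1 + d y ^ 2 + k y ^ 2 := fun y => by positivity
  have hbound : ∀ (a b : ℝ), |a| ≤ 1 + a ^ 2 + b ^ 2 := fun a b => by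
    nlinarith [sq_nonneg (|a| - 1), sq_abs a, sq_nonneg b]
  have hscale : ∀ g : C(X, ℝ), (∀ y, |g y| ≤ 1 + d y ^ 2 + k y ^ 2) →
      ∃ g' : X →ᵇ ℝ, ∀ y, g' y = g y / (1 + d y ^ 2 + k y ^ 2) := fun g hg =>
    ⟨.ofNormedAddCommGroup (fun y => g y / (1 + d y ^ 2 + k y ^ 2))
      (g.continuous.div (by fun_prop) fun y => (hpos y).ne') 1 fun y => by
        rw [Real.norm_eq_abs, abs_div, abs_of_pos (hpos y), div_le_one (hpos y)]
        exact hg y, fun y => rfl⟩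
  obtain ⟨d', hd'⟩ := hscale d fun y => hbound _ _
  obtain ⟨k', hk'⟩ := hscale k fun y => (hbound _ (d y)).trans_eq (by ring)
  refine ⟨d', k', ?_, fun y => ?_⟩
  · rw [hd']
    exact div_ne_zero hdx (hpos x).ne'
  · rw [hd', hk']
    exact mul_div_assoc _ _ _

variable (i) in
/-- The ideal of the functions `d` on `Y` for which the product of `f` and the restriction of `d`
to `X` extends to `Y`. Multiplication by `f` is a homomorphism from this ideal to `C(Y)`. -/
def multiplierIdeal (f : RealPartialFun (denseOpens X)) : Ideal C(Y, ℝ) where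
  carrier := {d | ∃ g : C(Y, ℝ), ∀ x ∈ f.dom, g (i x) = f.toFun x * d (i x)}
  zero_mem' := ⟨0, fun x _ => (mul_zero (f.toFun x)).symm⟩
  add_mem' := by
    rintro a b ⟨g, hg⟩ ⟨h, hh⟩
    exact ⟨g + h, fun x hx => by simp [hg x hx, hh x hx, mul_add]⟩
  smul_mem' := by
    rintro c a ⟨g, hg⟩
    exact ⟨c * g, fun x hx => by simp [hg x hx, mul_left_comm]⟩

variable [CompletelyRegularSpace X]

theorem exists_mem_multiplierIdeal_apply_ne_zero (hi : IsDenseCStarEmbedding i)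
    (f : RealPartialFun (denseOpens X)) {x : X} (hx : x ∈ f.dom) :
    ∃ d ∈ multiplierIdeal i f, d (i x) ≠ 0 := by
  obtain ⟨d, k, hdx, hk⟩ := exists_bounded_mul_eq_bounded f.mem.1 f.cont hx
  obtain ⟨d', hd'⟩ := hi.exists_extension d
  obtain ⟨k', hk'⟩ := hi.exists_extension k
  exact ⟨d', ⟨k', fun y _ => by rw [hk', hk, hd']⟩, by rwa [hd']⟩

theorem isRatDense_multiplierIdeal (hi : IsDenseCStarEmbedding i)
    (f : RealPartialFun (denseOpens X)) : IsRatDense (multiplierIdeal i f) := by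
  refine fun a ha => hi.eq_of_eqOn f.mem.2 fun x hx => ?_
  obtain ⟨d, hd, hdx⟩ := exists_mem_multiplierIdeal_apply_ne_zero hi f hx
  exact (mul_eq_zero.mp (DFunLike.congr_fun (ha d hd) (i x))).resolve_right hdx

/-- Multiplication by `f`, as an element of `Hom(D, C(Y))` for `D = multiplierIdeal i f`. -/
def multiplication (hi : IsDenseCStarEmbedding i) (f : RealPartialFun (denseOpens X)) :
    DenseHom C(Y, ℝ) where
  dom := multiplierIdeal i f
  dense := isRatDense_multiplierIdeal hi f
  map :=
    { toFun := fun d => d.2.choose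
      map_add' := fun a b => hi.eq_of_eqOn f.mem.2 fun x hx => by
        refine ((a + b).2.choose_spec x hx).trans ?_
        simp [a.2.choose_spec x hx, b.2.choose_spec x hx, mul_add]
      map_smul' := fun c a => hi.eq_of_eqOn f.mem.2 fun x hx => by
        refine ((c • a).2.choose_spec x hx).trans ?_
        simp [a.2.choose_spec x hx, mul_left_comm] }

theorem realizeFun_multiplication (hi : IsDenseCStarEmbedding i)
    (f : RealPartialFun (denseOpens X)) {x : X} (hx : x ∈ f.dom) :
    realizeFun (multiplication hi f) (i x) = f.toFun x :=
  realizeFun_eq_of_map_eq _ (exists_mem_multiplierIdeal_apply_ne_zero hi f hx)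
    fun d => d.2.choose_spec x hx

end CStarEmbedding

section StoneCech

variable {X : Type*} [TopologicalSpace X] [T35Space X]

theorem realize_surjective : Function.Surjective (realize (X := X)) := fun p => by
  induction p using Quotient.inductionOn with | _ f
  exact ⟨.mk (multiplication isDenseCStarEmbedding_id f),
    Quotient.sound fun _ hx => realizeFun_multiplication isDenseCStarEmbedding_id f hx.2⟩

theorem restrictStoneCech_surjective : Function.Surjective (restrictStoneCech X) := fun p => by
  induction p using Quotient.inductionOn with | _ f
  exact ⟨realize (.mk (multiplication isDenseCStarEmbedding_stoneCechUnit f)), Quotient.sound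
    fun _ hx => realizeFun_multiplication isDenseCStarEmbedding_stoneCechUnit f hx.2⟩

/-- The map `restrictStoneCech`, which restricts functions on dense open subsets of `βX` to `X`,
as a ring homomorphism. -/
def restrictStoneCechHom (X : Type*) [TopologicalSpace X] [T35Space X] :
    ContLimit (denseOpens (StoneCech X)) →+* ContLimit (denseOpens X) where
  toFun := restrictStoneCech X
  map_zero' := Quotient.sound fun _ _ => rfl
  map_one' := Quotient.sound fun _ _ => rfl
  map_add' p q := by
    induction p, q using Quotient.inductionOn₂
    rfl
  map_mul' p q := by
    induction p, q using Quotient.inductionOn₂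
    rfl

theorem isometry_restrictStoneCech : Isometry (restrictStoneCech X) := by
  refine ContLimit.isometry_of_size_map (restrictStoneCechHom X) fun p => ?_
  induction p using Quotient.inductionOn with | _ f
  have hdense : Dense (f.dom ∩ range (stoneCechUnit : X → StoneCech X)) :=
    f.mem.2.inter_of_isOpen_left denseRange_stoneCechUnit f.mem.1
  change truncSup (f.toFun ∘ stoneCechUnit) (stoneCechUnit ⁻¹' f.dom) = truncSup f.toFun f.dom
  rw [truncSup_dense f.cont hdense inter_subset_left, ← image_preimage_eq_inter_range]
  exact (truncSup_image _ _ _).symm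

/-- Restriction to `X` as an isomorphism from the ring of continuous functions on dense open
subsets of `βX` onto that of `X`. -/
def restrictStoneCechEquiv (X : Type*) [TopologicalSpace X] [T35Space X] :
    ContLimit (denseOpens (StoneCech X)) ≃+* ContLimit (denseOpens X) :=
  .ofBijective (restrictStoneCechHom X)
    ⟨isometry_restrictStoneCech.injective, restrictStoneCech_surjective⟩

theorem isometry_restrictStoneCechEquiv_symm : Isometry (restrictStoneCechEquiv X).symm :=
  isometry_restrictStoneCech.right_inv (restrictStoneCechEquiv X).apply_symm_apply

end StoneCech

end

/-- For a completely regular Hausdorff space `X`, the metric completion of `Q(X)` is the ring of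
continuous functions on dense `G_δ` subsets of `βX`, and, if `X` is a Baire space, also the ring
of continuous functions on dense `G_δ` subsets of `X`. The identifications are isometric, and on
`Q(X)` they are the canonical embeddings of rings of functions. -/
theorem mainTheorem3 (X : Type*) [TopologicalSpace X] [T35Space X] :
    (∃ (e : UniformSpace.Completion (QRing X) ≃ᵢ ContLimit (denseGδs (StoneCech X)))
        (ι : QRing X →+* ContLimit (denseGδs (StoneCech X))),
      (∀ q : QRing X, e (q : UniformSpace.Completion (QRing X)) = ι q) ∧
      ∀ q : QRing X, ∃ p : ContLimit (denseOpens (StoneCech X)),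
        restrictStoneCech X p = realize q ∧
        ι q = ContLimit.incl (denseOpens_subset_denseGδs (StoneCech X)) p) ∧
    (∀ [BaireSpace X],
      ∃ (e : UniformSpace.Completion (QRing X) ≃ᵢ ContLimit (denseGδs X))
        (ι : QRing X →+* ContLimit (denseGδs X)),
      (∀ q : QRing X, e (q : UniformSpace.Completion (QRing X)) = ι q) ∧
      ∀ q : QRing X, ι q = ContLimit.incl (denseOpens_subset_denseGδs X) (realize q)) := by
  refine ⟨?_, ?_⟩
  · let ρ := restrictStoneCechEquiv X
    obtain ⟨e, he⟩ := exists_completion_isometryEquiv_denseGδs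
      (isometry_restrictStoneCechEquiv_symm.comp isometry_realize)
      (ρ.symm.surjective.comp realize_surjective)
    exact ⟨e, (ContLimit.inclHom (denseOpens_subset_denseGδs (StoneCech X))).comp
      (ρ.symm.toRingHom.comp (realizeHom X)), he,
      fun q => ⟨ρ.symm (realize q), ρ.apply_symm_apply (realize q), rfl⟩⟩
  · intro _
    obtain ⟨e, he⟩ := exists_completion_isometryEquiv_denseGδs
      (isometry_realize (X := X)) realize_surjective
    exact ⟨e, (ContLimit.inclHom (denseOpens_subset_denseGδs X)).comp (realizeHom X), he,
      fun _ => rfl⟩
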